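/- Let $X$ be a real reflexive Banach space with dual $X^*$, and let $T(t)$, $t\ge 0$, be a $C_0$ semigroup on $X$ with generator $A$ on the domain $D_A$; let $A^*$ be the Banach space adjoint of $A$, with its natural domain $D_{A^*}\subseteq X^*$. Let $\mathcal L_s(X,X^*)$ be the Banach space (operator norm) of bounded operators $P:X\to X^*$ with $\langle Px,y\rangle=\langle Py,x\rangle$ for all $x,y\in X$; write $P\ge 0$ and call $P$ positive definite if $\langle Px,x\rangle\ge 0$ for all $x\in X$. The Lyapunov semigroup is $\mathcal T(t)P:=T^*(t)PT(t)$ on $\mathcal L_s(X,X^*)$. The Lyapunov generator $\mathcal A$ is its generator in the weak* topology, i.e. $\mathcal AP$ is the weak* limit of $\frac1t(\mathcal T(t)P-P)$ as $t\to0+$, with domain $\mathcal D_{\mathcal A}$ the set of $P$ for which this limit exists in $\mathcal L_s(X,X^*)$; here $\mathcal L_s(X,X^*)$ is regarded as the dual of the symmetric projective tensor product of $X$ with itself, which acts by $\langle\langle P,x\otimes y\rangle\rangle=\langle Px,y\rangle$. Let $\mathcal N$ be a real Hilbert space and $C:X\to\mathcal N$ a bounded operator such that the pair $(C,A)$ is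 detectable in $L^2$, i.e. for every $x\in X$ $$\int_0^\infty\|CT(t)x\|^2\,dt<\infty\implies\int_0^\infty\|T(t)x\|^2\,dt<\infty .$$ Let $C^*C:X\to X^*$ be the operator $\langle C^*Cx,y\rangle=(Cx,Cy)_{\mathcal N}$. For $P$ with $P(D_A)\subseteq D_{A^*}$ and $A^*P+PA$ bounded on $D_A$, let $\overline{A^*P+PA}$ be the unique bounded extension of $A^*P+PA$ from $D_A$ to $X$. Then the Lyapunov generator is given by $\mathcal AP=\overline{A^*P+PA}$ with domain $$\mathcal D_{\mathcal A}=\{P\in\mathcal L_s(X,X^*)\mid P(D_A)\subseteq D_{A^*},\ A^*P+PA\text{ is bounded on }D_A\},$$ and the following conditions are equivalent: (i) the Lyapunov equation $\overline{A^*P+PA}=-C^*C$ has a positive definite solution $P\in\mathcal L_s(X,X^*)$ with $P(D_A)\subseteq D_{A^*}$; (ii) $T(t)$ is exponentially stable, i.e. $\|T(t)\|\le Me^{-\varepsilon t}$ for all $t\ge0$, for some constants $M,\varepsilon>0$; (iii) the Lyapunov generator $\mathcal A$ has a bounded everywhere defined inverse $\mathcal A^{-1}$ on $\mathcal L_s(X,X^*)$,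 and $-\mathcal A^{-1}\ge0$, i.e. $-\mathcal A^{-1}Q\ge 0$ for every $Q\ge 0$. -/

import Mathlib

open Filter Topology MeasureTheory Set

noncomputable section

namespace Lyapunov

variable {X : Type*} [NormedAddCommGroup X] [NormedSpace ℝ X]
variable {N : Type*} [NormedAddCommGroup N] [InnerProductSpace ℝ N]

/-- A normed space is reflexive if the canonical embedding into its bidual is onto. -/
def IsReflexive (X : Type*) [NormedAddCommGroup X] [NormedSpace ℝ X] : Prop :=
  Function.Surjective (NormedSpace.inclusionInDoubleDual ℝ X)

/-- `T` is a `C₀` semigroup of bounded operators; only its values at times `t ≥ 0` matter. -/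
structure IsC0Semigroup (T : ℝ → X →L[ℝ] X) : Prop where
  map_zero : T 0 = ContinuousLinearMap.id ℝ X
  map_add : ∀ s t : ℝ, 0 ≤ s → 0 ≤ t → T (s + t) = (T s).comp (T t)
  continuousOn : ∀ x : X, ContinuousOn (fun t => T t x) (Ici 0)

/-- The graph of the infinitesimal generator:
pairs `(x, y)` with `y = lim_{t → 0+} (T(t) x - x) / t` in norm. -/
def generatorGraph (T : ℝ → X →L[ℝ] X) : Submodule ℝ (X × X) where
  carrier := {p | Tendsto (fun t : ℝ => t⁻¹ • (T t p.1 - p.1)) (𝓝[>] 0) (𝓝 p.2)}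
  zero_mem' := by simp
  add_mem' := by
    intro p q hp hq
    refine (Tendsto.add hp hq).congr fun t => ?_
    rw [← smul_add, Prod.fst_add, map_add]
    congr 1
    abel
  smul_mem' := by
    intro c p hp
    refine (Tendsto.const_smul hp c).congr fun t => ?_
    rw [smul_comm, Prod.smul_fst, map_smul, smul_sub]

/-- The infinitesimal generator `A`, with its natural domain `D_A`. -/
def generator (T : ℝ → X →L[ℝ] X) : X →ₗ.[ℝ] X :=
  (generatorGraph T).toLinearPMap

theorem generator_graph (T : ℝ → X →L[ℝ] X) : (generator T).graph = generatorGraph T := by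
  refine Submodule.toLinearPMap_graph_eq _ ?_
  rintro ⟨x, y⟩ h (rfl : x = 0)
  have h' : Tendsto (fun t : ℝ => t⁻¹ • (T t (0 : X) - 0)) (𝓝[>] 0) (𝓝 y) := h
  simp only [map_zero, sub_zero, smul_zero] at h'
  exact (tendsto_nhds_unique h' tendsto_const_nhds)

/-- The graph of the Banach space adjoint `A*`:
pairs `(φ, ψ)` with `⟨ψ, x⟩ = ⟨φ, A x⟩` for all `x ∈ D_A`. -/
def adjointGraph (A : X →ₗ.[ℝ] X) : Submodule ℝ (StrongDual ℝ X × StrongDual ℝ X) where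
  carrier := {p | ∀ x : A.domain, p.2 (x : X) = p.1 (A x)}
  zero_mem' := by simp
  add_mem' := by
    intro p q hp hq x
    simp [hp x, hq x]
  smul_mem' := by
    intro c p hp x
    simp [hp x]

/-- The adjoint `A*` on `X*` of a densely defined operator `A`, with its natural domain `D_{A*}`,
i.e. the functionals `φ` for which `x ↦ ⟨φ, A x⟩` is bounded on `D_A`. -/
def adjoint (A : X →ₗ.[ℝ] X) : StrongDual ℝ X →ₗ.[ℝ] StrongDual ℝ X :=
  (adjointGraph A).toLinearPMap

theorem adjoint_graph (A : X →ₗ.[ℝ] X) (hA : Dense (A.domain : Set X)) :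
    (adjoint A).graph = adjointGraph A := by
  refine Submodule.toLinearPMap_graph_eq _ ?_
  rintro ⟨φ, ψ⟩ h (rfl : φ = 0)
  have h' : ∀ x : A.domain, ψ (x : X) = (0 : StrongDual ℝ X) (A x) := h
  refine ContinuousLinearMap.coeFn_injective
    (Continuous.ext_on hA ψ.continuous continuous_const fun x hx => ?_)
  simpa using h' ⟨x, hx⟩

/-- The adjoint `S* : Y* → X*` of a bounded operator `S : X → Y`. -/
def boundedAdjoint {Y : Type*} [NormedAddCommGroup Y] [NormedSpace ℝ Y] (S : X →L[ℝ] Y) :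
    StrongDual ℝ Y →L[ℝ] StrongDual ℝ X :=
  ContinuousLinearMap.precomp ℝ S

/-- `C* C : X → X*`, the Hilbert space `N` being identified with its dual. -/
def starMul (C : X →L[ℝ] N) : X →L[ℝ] StrongDual ℝ X :=
  (boundedAdjoint C).comp ((innerSL ℝ).comp C)

theorem starMul_apply (C : X →L[ℝ] N) (x y : X) : starMul C x y = inner ℝ (C x) (C y) := rfl

/-- Subspaces of a normed space, with the module structure taken from the norm. -/
abbrev NormedSubmodule (E : Type*) [NormedAddCommGroup E] [NormedSpace ℝ E] := Submodule ℝ E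

/-- The symmetric operators `X → X*` as a subspace of the bounded operators.
For reflexive `X`, with `X** = X`, the condition is `P* = P`. -/
def symmetricOperators (X : Type*) [NormedAddCommGroup X] [NormedSpace ℝ X] :
    NormedSubmodule (X →L[ℝ] StrongDual ℝ X) where
  carrier := {P | ∀ x y : X, P x y = P y x}
  zero_mem' := by simp
  add_mem' := by
    intro P Q hP hQ x y
    simp [hP x y, hQ x y]
  smul_mem' := by
    intro c P hP x y
    simp [hP x y]

/-- The space `L_s(X, X*)` of bounded symmetric operators, with the operator norm. -/
def Ls (X : Type*) [NormedAddCommGroup X] [NormedSpace ℝ X] : Type _ := symmetricOperators X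

instance : NormedAddCommGroup (Ls X) :=
  inferInstanceAs (NormedAddCommGroup (symmetricOperators X))

instance : NormedSpace ℝ (Ls X) :=
  inferInstanceAs (NormedSpace ℝ (symmetricOperators X))

/-- The inclusion of `L_s(X, X*)` into the bounded operators. -/
def Ls.toOp : Ls X →L[ℝ] (X →L[ℝ] StrongDual ℝ X) := (symmetricOperators X).subtypeL

theorem Ls.symm (P : Ls X) (x y : X) : P.toOp x y = P.toOp y x := P.2 x y

theorem Ls.norm_toOp (P : Ls X) : ‖P.toOp‖ = ‖P‖ := rfl

theorem Ls.ext {P Q : Ls X} (h : P.toOp = Q.toOp) : P = Q := Subtype.ext h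

/-- A bounded operator with `⟨P x, y⟩ = ⟨P y, x⟩`, as an element of `L_s(X, X*)`. -/
def Ls.mk (P : X →L[ℝ] StrongDual ℝ X) (hP : ∀ x y, P x y = P y x) : Ls X := ⟨P, hP⟩

theorem Ls.toOp_mk (P : X →L[ℝ] StrongDual ℝ X) (hP : ∀ x y, P x y = P y x) :
    (Ls.mk P hP).toOp = P := rfl

/-- The positive cone of `L_s(X, X*)`: operators `P` with `⟨P x, x⟩ ≥ 0` for all `x`. -/
def IsPosDef (P : Ls X) : Prop := ∀ x : X, 0 ≤ P.toOp x x

/-- The operator `P ↦ S* P S` on `L_s(X, X*)`. -/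
def conj (S : X →L[ℝ] X) : Ls X →L[ℝ] Ls X :=
  LinearMap.mkContinuous
    { toFun := fun P => Ls.mk ((boundedAdjoint S).comp (P.toOp.comp S))
        fun x y => by
          change P.toOp (S x) (S y) = P.toOp (S y) (S x)
          exact P.symm (S x) (S y)
      map_add' := fun _ _ => Ls.ext (by ext x y; rfl)
      map_smul' := fun _ _ => Ls.ext (by ext x y; rfl) }
    (‖boundedAdjoint S‖ * ‖S‖) fun P => by
      change ‖(boundedAdjoint S).comp (P.toOp.comp S)‖ ≤ ‖boundedAdjoint S‖ * ‖S‖ * ‖P.toOp‖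
      rw [mul_assoc, mul_comm ‖S‖]
      exact (ContinuousLinearMap.opNorm_comp_le _ _).trans
        (mul_le_mul_of_nonneg_left (ContinuousLinearMap.opNorm_comp_le _ _) (norm_nonneg _))

theorem toOp_conj (S : X →L[ℝ] X) (P : Ls X) :
    (conj S P).toOp = (boundedAdjoint S).comp (P.toOp.comp S) := rfl

/-- The Lyapunov semigroup `𝒯(t) P = T*(t) P T(t)` on `L_s(X, X*)`. -/
def lyapunovSemigroup (T : ℝ → X →L[ℝ] X) (t : ℝ) : Ls X →L[ℝ] Ls X := conj (T t)

/-- The functional `P ↦ ⟨P x, y⟩` on `L_s(X, X*)`, given by the symmetrization of `x ⊗ y`. -/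
def tensorFunctional (x y : X) : StrongDual ℝ (Ls X) :=
  (ContinuousLinearMap.apply ℝ ℝ y).comp
    ((ContinuousLinearMap.apply ℝ (StrongDual ℝ X) x).comp Ls.toOp)

theorem tensorFunctional_apply (x y : X) (P : Ls X) :
    tensorFunctional x y P = P.toOp x y := rfl

/-- The predual of `L_s(X, X*)`, i.e. the symmetric projective tensor product of `X` with itself,
realized isometrically as a subspace of the dual of `L_s(X, X*)`: the norm closure of the span of
the functionals `P ↦ ⟨P x, y⟩`. -/
def predual (X : Type*) [NormedAddCommGroup X] [NormedSpace ℝ X] :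
    Submodule ℝ (StrongDual ℝ (Ls X)) :=
  (Submodule.span ℝ {ρ | ∃ x y : X, ρ = tensorFunctional x y}).topologicalClosure

/-- The graph of the generator of the Lyapunov semigroup in the weak* topology of `L_s(X, X*)`:
pairs `(P, Q)` with `Q = lim_{t → 0+} (𝒯(t) P - P) / t` weakly*. -/
def lyapunovGeneratorGraph (T : ℝ → X →L[ℝ] X) : Submodule ℝ (Ls X × Ls X) where
  carrier := {p | ∀ ρ ∈ predual X,
    Tendsto (fun t : ℝ => ρ (t⁻¹ • (lyapunovSemigroup T t p.1 - p.1))) (𝓝[>] 0) (𝓝 (ρ p.2))}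
  zero_mem' := by simp
  add_mem' := by
    intro p q hp hq ρ hρ
    rw [Prod.snd_add, map_add]
    refine (Tendsto.add (hp ρ hρ) (hq ρ hρ)).congr fun t => ?_
    rw [← map_add, ← smul_add, Prod.fst_add, map_add]
    congr 2
    abel
  smul_mem' := by
    intro c p hp ρ hρ
    rw [Prod.smul_snd, map_smul]
    refine (Tendsto.const_smul (hp ρ hρ) c).congr fun t => ?_
    rw [← map_smul, smul_comm, Prod.smul_fst, (lyapunovSemigroup T t).map_smul, smul_sub]

/-- The Lyapunov generator: the generator of the Lyapunov semigroup. -/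
def lyapunovGenerator (T : ℝ → X →L[ℝ] X) : Ls X →ₗ.[ℝ] Ls X :=
  (lyapunovGeneratorGraph T).toLinearPMap

theorem lyapunovGenerator_graph (T : ℝ → X →L[ℝ] X) :
    (lyapunovGenerator T).graph = lyapunovGeneratorGraph T := by
  refine Submodule.toLinearPMap_graph_eq _ ?_
  rintro ⟨P, Q⟩ h (rfl : P = 0)
  refine Ls.ext (ContinuousLinearMap.ext fun x => ContinuousLinearMap.ext fun y => ?_)
  have h' : Tendsto (fun t : ℝ => tensorFunctional x y
      (t⁻¹ • (lyapunovSemigroup T t (0 : Ls X) - 0))) (𝓝[>] 0) (𝓝 (tensorFunctional x y Q)) :=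
    h _ (Submodule.le_topologicalClosure _ (Submodule.subset_span ⟨x, y, rfl⟩))
  simp only [map_zero, sub_zero, smul_zero] at h'
  exact tendsto_nhds_unique h' tendsto_const_nhds

/-- `P` maps `D_A` into `D_{A*}`, and the operator `A* P + P A : D_A → X*` extends to the bounded
operator `Q` on `X`, i.e. `Q` is the closure of `A* P + P A`. -/
def IsLyapunovExtension (A : X →ₗ.[ℝ] X) (P Q : X →L[ℝ] StrongDual ℝ X) : Prop :=
  ∀ x : A.domain, ∃ h : P (x : X) ∈ (adjoint A).domain,
    Q (x : X) = adjoint A ⟨P (x : X), h⟩ + P (A x)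

/-- The graph of `P ↦ closure (A* P + P A)` on its natural domain, the set of `P ∈ L_s(X, X*)` with
`P D_A ⊆ D_{A*}` and `A* P + P A` bounded. -/
def lyapunovOperatorGraph (A : X →ₗ.[ℝ] X) : Submodule ℝ (Ls X × Ls X) where
  carrier := {p | IsLyapunovExtension A p.1.toOp p.2.toOp}
  zero_mem' := by
    intro x
    refine ⟨(adjoint A).domain.zero_mem, ?_⟩
    have h : (0 : StrongDual ℝ X) = adjoint A 0 + 0 := by rw [LinearPMap.map_zero, add_zero]
    exact h
  add_mem' := by
    intro p q hp hq x
    obtain ⟨h₁, e₁⟩ := hp x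
    obtain ⟨h₂, e₂⟩ := hq x
    refine ⟨(adjoint A).domain.add_mem h₁ h₂, ?_⟩
    have h : p.2.toOp (x : X) + q.2.toOp (x : X) = adjoint A (⟨_, h₁⟩ + ⟨_, h₂⟩) +
        (p.1.toOp (A x) + q.1.toOp (A x)) := by
      rw [LinearPMap.map_add, e₁, e₂]
      abel
    exact h
  smul_mem' := by
    intro c p hp x
    obtain ⟨h₁, e₁⟩ := hp x
    refine ⟨(adjoint A).domain.smul_mem c h₁, ?_⟩
    have h : c • p.2.toOp (x : X) = adjoint A (c • ⟨_, h₁⟩) + c • p.1.toOp (A x) := by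
      rw [LinearPMap.map_smul, e₁, smul_add]
    exact h

/-- The operator `P ↦ closure (A* P + P A)` on its natural domain. -/
def lyapunovOperator (A : X →ₗ.[ℝ] X) : Ls X →ₗ.[ℝ] Ls X :=
  (lyapunovOperatorGraph A).toLinearPMap

theorem lyapunovOperator_graph (A : X →ₗ.[ℝ] X) (hA : Dense (A.domain : Set X)) :
    (lyapunovOperator A).graph = lyapunovOperatorGraph A := by
  refine Submodule.toLinearPMap_graph_eq _ ?_
  rintro ⟨P, Q⟩ h (rfl : P = 0)
  refine Ls.ext (ContinuousLinearMap.coeFn_injective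
    (Continuous.ext_on hA Q.toOp.continuous continuous_const fun x hx => ?_))
  obtain ⟨h₀, e⟩ := h ⟨x, hx⟩
  have h' : adjoint A 0 + 0 = (0 : StrongDual ℝ X) := by rw [LinearPMap.map_zero, add_zero]
  exact e.trans h'

/-- The pair `(C, A)` is detectable in `L²`, where `A` is the generator of `T`. -/
def IsDetectable (C : X →L[ℝ] N) (T : ℝ → X →L[ℝ] X) : Prop :=
  ∀ x : X, IntegrableOn (fun t : ℝ => ‖C (T t x)‖ ^ 2) (Ioi 0) volume →
    IntegrableOn (fun t : ℝ => ‖T t x‖ ^ 2) (Ioi 0) volume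

/-- Exponential stability in the operator norm. -/
def IsExpStable (T : ℝ → X →L[ℝ] X) : Prop :=
  ∃ M ε : ℝ, 0 < ε ∧ ∀ t : ℝ, 0 ≤ t → ‖T t‖ ≤ M * Real.exp (-ε * t)

/-- `R` is a bounded everywhere defined inverse of the unbounded operator `B`. -/
def IsBoundedInverse {E : Type*} [NormedAddCommGroup E] [NormedSpace ℝ E] (B : E →ₗ.[ℝ] E)
    (R : E →L[ℝ] E) : Prop :=
  (∀ P : B.domain, R (B P) = P) ∧ ∀ Q : E, ∃ h : R Q ∈ B.domain, B ⟨R Q, h⟩ = Q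

end Lyapunov

end

namespace Lyapunov

/-! Everything rests on one integrated identity. If `Q` extends `A* P + P A`, then for `x, y ∈ D_A`
the function `s ↦ ⟨P T(s)x, T(s)y⟩` has right derivative `⟨Q T(s)x, T(s)y⟩`. Integrating over `[0,
t]`, and extending from `D_A` to `X` by density, gives `∫₀ᵗ ⟨Q T(s)x, T(s)y⟩ ds = ⟨P T(t)x, T(t)y⟩ -
⟨P x, y⟩` for all `x, y` (`integral_eq_of_isLyapunovExtension`).

The identity bounds the difference quotients of the Lyapunov semigroup at `P` near `0`, so their
convergence to `Q` on elementary tensors passes to the whole predual. Conversely, a weak* derivative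
tested on `x ⊗ y` with `x, y ∈ D_A` gives back the algebraic equation by the product rule. Hence the
two operators have the same graph.

For (i) → (ii), put `x = y` and `Q = -C*C`: positivity of `P` bounds `∫₀ᵗ ‖C T(s)x‖² ds` by `⟨P x,
x⟩`, detectability makes the orbits square integrable, and Datko's theorem applies. For (ii) →
(iii), the inverse is `Q ↦ -∫₀^∞ T*(s) Q T(s) ds`, whose negative preserves positivity. For (iii) →
(i), take `P = -𝒜⁻¹(C*C)`. -/

/-! ### Averages of continuous functions and weak* convergence -/

theorem tendsto_average_of_continuousOn {E : Type*} [NormedAddCommGroup E] [NormedSpace ℝ E]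
    [CompleteSpace E] {f : ℝ → E} (hf : ContinuousOn f (Ici 0)) {t : ℝ} (ht : 0 ≤ t) :
    Tendsto (fun h : ℝ => h⁻¹ • ((∫ s in (0 : ℝ)..t + h, f s) - ∫ s in (0 : ℝ)..t, f s))
      (𝓝[>] 0) (𝓝 (f t)) := by
  -- Freezing `f` at `f 0` on the negative axis makes it continuous on the whole line, without
  -- changing the integrals involved.
  have hg : Continuous fun s : ℝ => f (max s 0) :=
    hf.comp_continuous (by fun_prop) fun s => le_max_right s 0
  have key : ∀ u : ℝ, 0 ≤ u → ∫ s in (0 : ℝ)..u, f (max s 0) = ∫ s in (0 : ℝ)..u, f s := by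
    intro u hu
    refine intervalIntegral.integral_congr fun s hs => ?_
    rw [uIcc_of_le hu] at hs
    simp only [max_eq_left hs.1]
  have h := (hg.integral_hasStrictDerivAt 0 t).hasDerivAt.tendsto_slope_zero_right
  rw [max_eq_left ht] at h
  refine h.congr' ?_
  filter_upwards [self_mem_nhdsWithin] with h hh
  rw [key _ (add_nonneg ht (le_of_lt hh)), key _ ht]

theorem intervalIntegrable_of_continuousOn_Ici {E : Type*} [NormedAddCommGroup E]
    {f : ℝ → E} (hf : ContinuousOn f (Ici 0)) {a b : ℝ} (ha : 0 ≤ a) (hb : 0 ≤ b) :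
    IntervalIntegrable f volume a b :=
  (hf.mono fun _ hs => (le_inf ha hb).trans hs.1).intervalIntegrable

/-- Convergence along a bounded family passes from a set of functionals to the norm closure of its
span. -/
theorem tendsto_of_mem_topologicalClosure_span {E ι : Type*} [NormedAddCommGroup E]
    [NormedSpace ℝ E] {l : Filter ι} {u : ι → E} {q : E} {K : ℝ} (hu : ∀ᶠ i in l, ‖u i‖ ≤ K)
    {S : Set (StrongDual ℝ E)} (hS : ∀ ρ ∈ S, Tendsto (fun i => ρ (u i)) l (𝓝 (ρ q)))
    {ρ : StrongDual ℝ E} (hρ : ρ ∈ (Submodule.span ℝ S).topologicalClosure) :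
    Tendsto (fun i => ρ (u i)) l (𝓝 (ρ q)) := by
  have hspan : ∀ σ ∈ Submodule.span ℝ S, Tendsto (fun i => σ (u i)) l (𝓝 (σ q)) := by
    intro σ hσ
    induction hσ using Submodule.span_induction with
    | mem σ h => exact hS σ h
    | zero => exact tendsto_const_nhds
    | add σ τ _ _ h₁ h₂ => exact h₁.add h₂
    | smul c σ _ h => exact h.const_smul c
  rw [Metric.tendsto_nhds]
  intro ε hε
  have hL : 0 < |K| + ‖q‖ + 1 := by positivity
  -- The tolerance is chosen so that replacing `ρ` by `σ` costs less than `ε / 2` on every `u i -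
  -- q`; the summand `1` keeps the divisor positive.
  obtain ⟨σ, hσ, hd⟩ := Metric.mem_closure_iff.1 hρ (ε / 2 / (|K| + ‖q‖ + 1)) (by positivity)
  rw [dist_eq_norm, lt_div_iff₀ hL] at hd
  filter_upwards [hu, Metric.tendsto_nhds.1 (hspan σ hσ) (ε / 2) (by positivity)] with i hi hi'
  have h₁ : ‖u i - q‖ ≤ |K| + ‖q‖ + 1 := by
    linarith [norm_sub_le (u i) q, le_abs_self K]
  have h₂ : ‖(ρ - σ) (u i - q)‖ < ε / 2 :=
    (((ρ - σ).le_opNorm _).trans (mul_le_mul_of_nonneg_left h₁ (norm_nonneg _))).trans_lt hd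
  rw [dist_eq_norm] at hi' ⊢
  have h₃ : ρ (u i) - ρ q = (ρ - σ) (u i - q) + (σ (u i) - σ q) := by
    simp only [sub_apply, map_sub]
    ring
  rw [h₃]
  linarith [norm_add_le ((ρ - σ) (u i - q)) (σ (u i) - σ q)]

/-! ### Orbits and generator of a `C₀` semigroup -/

variable {X : Type*} [NormedAddCommGroup X] [NormedSpace ℝ X]
variable {T : ℝ → X →L[ℝ] X}

theorem IsC0Semigroup.add_apply (hT : IsC0Semigroup T) {s t : ℝ} (hs : 0 ≤ s) (ht : 0 ≤ t)
    (x : X) : T (s + t) x = T s (T t x) := by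
  rw [hT.map_add s t hs ht, ContinuousLinearMap.comp_apply]

theorem IsC0Semigroup.zero_apply (hT : IsC0Semigroup T) (x : X) : T 0 x = x := by
  rw [hT.map_zero, ContinuousLinearMap.id_apply]

theorem IsC0Semigroup.tendsto_zero (hT : IsC0Semigroup T) (x : X) :
    Tendsto (fun t => T t x) (𝓝[>] 0) (𝓝 x) := by
  have h : Tendsto (fun t => T t x) (𝓝[≥] 0) (𝓝 (T 0 x)) := hT.continuousOn x 0 self_mem_Ici
  rw [hT.zero_apply] at h
  exact h.mono_left (nhdsWithin_mono 0 Ioi_subset_Ici_self)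

theorem IsC0Semigroup.exists_norm_le [CompleteSpace X] (hT : IsC0Semigroup T) (b : ℝ) :
    ∃ M : ℝ, ∀ t ∈ Icc 0 b, ‖T t‖ ≤ M := by
  obtain ⟨M, hM⟩ := banach_steinhaus (g := fun t : Icc (0 : ℝ) b => T t) fun x => by
    obtain ⟨K, hK⟩ := isCompact_Icc.exists_bound_of_continuousOn
      ((hT.continuousOn x).mono (fun _ ht => ht.1 : Icc 0 b ⊆ Ici 0))
    exact ⟨K, fun t => hK t t.2⟩
  exact ⟨M, fun t ht => hM ⟨t, ht⟩⟩

theorem IsC0Semigroup.continuousOn_form (hT : IsC0Semigroup T) (Q : X →L[ℝ] StrongDual ℝ X)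
    (x y : X) : ContinuousOn (fun s => Q (T s x) (T s y)) (Ici 0) :=
  (Q.continuous.comp_continuousOn (hT.continuousOn x)).clm_apply (hT.continuousOn y)

/-- The generator is a limit at `0+`, and `T(t) = T(s) T(t - s)` carries it to any `s ≥ 0`. The
right derivative is enough for the fundamental theorem of calculus used later. -/
theorem IsC0Semigroup.hasDerivWithinAt (hT : IsC0Semigroup T) {x x' : X}
    (hx : (x, x') ∈ generatorGraph T) {s : ℝ} (hs : 0 ≤ s) :
    HasDerivWithinAt (fun t => T t x) (T s x') (Ioi s) s := by
  rw [hasDerivWithinAt_iff_tendsto_slope' self_notMem_Ioi]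
  have h₀ : Tendsto (fun t : ℝ => t - s) (𝓝[>] s) (𝓝[>] 0) := by
    refine tendsto_nhdsWithin_iff.2 ⟨?_, ?_⟩
    · have h : Tendsto (fun t : ℝ => t - s) (𝓝 s) (𝓝 (s - s)) :=
        (continuous_id.sub continuous_const).tendsto s
      rw [sub_self] at h
      exact h.mono_left nhdsWithin_le_nhds
    · filter_upwards [self_mem_nhdsWithin] with t ht using sub_pos.2 (mem_Ioi.1 ht)
  have h₁ : Tendsto (fun t : ℝ => t⁻¹ • (T t x - x)) (𝓝[>] 0) (𝓝 x') := hx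
  refine (((T s).continuous.tendsto x').comp (h₁.comp h₀)).congr' ?_
  filter_upwards [self_mem_nhdsWithin] with t ht
  have h₂ : T t x = T s (T (t - s) x) := by
    rw [← hT.add_apply hs (sub_nonneg.2 (le_of_lt ht)), add_sub_cancel]
  simp only [Function.comp_apply, slope_def_module, map_smul, map_sub, h₂]

theorem IsC0Semigroup.apply_mem_generatorGraph (hT : IsC0Semigroup T) {x x' : X}
    (hx : (x, x') ∈ generatorGraph T) {s : ℝ} (hs : 0 ≤ s) :
    (T s x, T s x') ∈ generatorGraph T := by
  have h₁ : Tendsto (fun t : ℝ => t⁻¹ • (T t x - x)) (𝓝[>] 0) (𝓝 x') := hx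
  change Tendsto (fun t : ℝ => t⁻¹ • (T t (T s x) - T s x)) (𝓝[>] 0) (𝓝 (T s x'))
  refine (((T s).continuous.tendsto x').comp h₁).congr' ?_
  filter_upwards [self_mem_nhdsWithin] with t ht
  have ht' : 0 ≤ t := le_of_lt ht
  rw [← hT.add_apply ht' hs, add_comm, hT.add_apply hs ht']
  simp only [Function.comp_apply, map_smul, map_sub]

/-- Applying `T h` shifts the interval of integration, so the difference quotient is a difference of
averages at `t` and at `0`. These integrals supply the elements that make `D_A` dense. -/
theorem IsC0Semigroup.integral_mem_generatorGraph [CompleteSpace X] (hT : IsC0Semigroup T) (x : X)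
    {t : ℝ} (ht : 0 ≤ t) : (∫ s in (0 : ℝ)..t, T s x, T t x - x) ∈ generatorGraph T := by
  have hc := hT.continuousOn x
  have h₁ := (tendsto_average_of_continuousOn hc ht).sub
    (tendsto_average_of_continuousOn hc le_rfl)
  rw [hT.zero_apply] at h₁
  refine Tendsto.congr' ?_ h₁
  filter_upwards [self_mem_nhdsWithin] with h hh
  have hh' : 0 ≤ h := le_of_lt hh
  have h₂ : T h (∫ s in (0 : ℝ)..t, T s x) =
      (∫ s in (0 : ℝ)..t + h, T s x) - ∫ s in (0 : ℝ)..h, T s x := by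
    rw [← (T h).intervalIntegral_comp_comm (intervalIntegrable_of_continuousOn_Ici hc le_rfl ht),
      intervalIntegral.integral_interval_sub_left
        (intervalIntegrable_of_continuousOn_Ici hc le_rfl (add_nonneg ht hh'))
        (intervalIntegrable_of_continuousOn_Ici hc le_rfl hh')]
    have h₃ := intervalIntegral.integral_comp_add_right (fun s => T s x) h (a := 0) (b := t)
    rw [zero_add] at h₃
    rw [← h₃]
    refine intervalIntegral.integral_congr fun s hs => ?_
    rw [uIcc_of_le ht] at hs
    simp only [add_comm s h, hT.add_apply hh' hs.1]
  rw [h₂, zero_add, intervalIntegral.integral_same, ← smul_sub]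
  congr 1
  abel

theorem mem_generator_domain_iff {x : X} :
    x ∈ (generator T).domain ↔ ∃ x', (x, x') ∈ generatorGraph T := by
  rw [LinearPMap.mem_domain_iff, generator_graph]

theorem IsC0Semigroup.dense_domain [CompleteSpace X] (hT : IsC0Semigroup T) :
    Dense ((generator T).domain : Set X) := by
  intro x
  have h := tendsto_average_of_continuousOn (hT.continuousOn x) le_rfl
  rw [hT.zero_apply] at h
  refine mem_closure_of_tendsto h ?_
  filter_upwards [self_mem_nhdsWithin] with t ht
  rw [zero_add, intervalIntegral.integral_same, sub_zero]
  exact Submodule.smul_mem _ _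
    (mem_generator_domain_iff.2 ⟨_, hT.integral_mem_generatorGraph x (le_of_lt ht)⟩)

/-! ### Integrals of the Lyapunov semigroup, defined weakly -/

/-- The operator `Q ↦ ∫ T*(s) Q T(s) dμ(s)` on `L_s(X, X*)`. -/
theorem exists_integral_conj {μ : Measure ℝ} {b : ℝ → ℝ} (hb : Integrable b μ)
    (hT : ∀ x, AEStronglyMeasurable (fun s => T s x) μ) (hle : ∀ᵐ s ∂μ, ‖T s‖ ^ 2 ≤ b s) :
    ∃ R : Ls X →L[ℝ] Ls X, ∀ (Q : Ls X) (x y : X),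
      Integrable (fun s => Q.toOp (T s x) (T s y)) μ ∧
      (R Q).toOp x y = ∫ s, Q.toOp (T s x) (T s y) ∂μ := by
  have hbd : ∀ (Q : Ls X) (x y : X),
      ∀ᵐ s ∂μ, ‖Q.toOp (T s x) (T s y)‖ ≤ ‖Q‖ * ‖x‖ * ‖y‖ * b s := by
    intro Q x y
    filter_upwards [hle] with s hs
    calc ‖Q.toOp (T s x) (T s y)‖ ≤ ‖Q.toOp‖ * ‖T s x‖ * ‖T s y‖ := Q.toOp.le_opNorm₂ _ _
      _ ≤ ‖Q‖ * (‖T s‖ * ‖x‖) * (‖T s‖ * ‖y‖) := by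
        rw [Ls.norm_toOp]
        gcongr <;> exact (T s).le_opNorm _
      _ = ‖Q‖ * ‖x‖ * ‖y‖ * ‖T s‖ ^ 2 := by ring
      _ ≤ _ := by gcongr
  have hint : ∀ (Q : Ls X) (x y : X), Integrable (fun s => Q.toOp (T s x) (T s y)) μ := by
    intro Q x y
    refine (hb.const_mul (‖Q‖ * ‖x‖ * ‖y‖)).mono' ?_ (hbd Q x y)
    have hc : Continuous fun p : X × X => Q.toOp p.1 p.2 := by fun_prop
    exact hc.comp_aestronglyMeasurable ((hT x).prodMk (hT y))
  have hnorm : ∀ (Q : Ls X) (x y : X),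
      ‖∫ s, Q.toOp (T s x) (T s y) ∂μ‖ ≤ (∫ s, b s ∂μ) * ‖Q‖ * ‖x‖ * ‖y‖ := by
    intro Q x y
    refine (norm_integral_le_of_norm_le (hb.const_mul _) (hbd Q x y)).trans_eq ?_
    rw [integral_const_mul]
    ring
  have hb0 : 0 ≤ ∫ s, b s ∂μ := integral_nonneg_of_ae
    (hle.mono fun s hs => (sq_nonneg ‖T s‖).trans hs)
  let B : Ls X → X →L[ℝ] StrongDual ℝ X := fun Q => LinearMap.mkContinuous₂
    (LinearMap.mk₂ ℝ (fun x y => ∫ s, Q.toOp (T s x) (T s y) ∂μ)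
      (fun x x' y => by
        rw [← integral_add (hint Q x y) (hint Q x' y)]
        simp only [map_add, add_apply])
      (fun c x y => by
        rw [smul_eq_mul, ← integral_const_mul]
        simp only [map_smul, smul_apply, smul_eq_mul])
      (fun x y y' => by
        rw [← integral_add (hint Q x y) (hint Q x y')]
        simp only [map_add])
      (fun c x y => by
        rw [smul_eq_mul, ← integral_const_mul]
        simp only [map_smul, smul_eq_mul]))
    ((∫ s, b s ∂μ) * ‖Q‖) (hnorm Q)
  have hB : ∀ Q x y, B Q x y = ∫ s, Q.toOp (T s x) (T s y) ∂μ := fun _ _ _ => rfl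
  refine ⟨LinearMap.mkContinuous
    { toFun := fun Q => Ls.mk (B Q) fun x y => by simp only [hB, Q.symm (T _ x)]
      map_add' := fun P Q => Ls.ext (by
        ext x y
        change ∫ s, (P + Q).toOp (T s x) (T s y) ∂μ =
          (∫ s, P.toOp (T s x) (T s y) ∂μ) + ∫ s, Q.toOp (T s x) (T s y) ∂μ
        rw [← integral_add (hint P x y) (hint Q x y)]
        simp only [map_add, add_apply])
      map_smul' := fun c Q => Ls.ext (by
        ext x y
        change ∫ s, (c • Q).toOp (T s x) (T s y) ∂μ = c * ∫ s, Q.toOp (T s x) (T s y) ∂μ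
        rw [← integral_const_mul]
        simp only [map_smul, smul_apply, smul_eq_mul]) }
    (∫ s, b s ∂μ) fun Q => ?_, fun Q x y => ⟨hint Q x y, rfl⟩⟩
  exact ContinuousLinearMap.opNorm_le_bound₂ (B Q) (mul_nonneg hb0 (norm_nonneg Q)) (hnorm Q)

/-! ### The Lyapunov equation: weak, integrated and generator forms -/

/-- The weak form of the equation `closure (A* P + P A) = Q`. -/
theorem isLyapunovExtension_iff [CompleteSpace X] (hT : IsC0Semigroup T)
    (P Q : X →L[ℝ] StrongDual ℝ X) :
    IsLyapunovExtension (generator T) P Q ↔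
      ∀ x x' y y' : X, (x, x') ∈ generatorGraph T → (y, y') ∈ generatorGraph T →
        Q x y = P x y' + P x' y := by
  have hd := hT.dense_domain
  constructor
  · intro h x x' y y' hx hy
    rw [← generator_graph, LinearPMap.mem_graph_iff] at hx hy
    obtain ⟨u, rfl, rfl⟩ := hx
    obtain ⟨v, rfl, rfl⟩ := hy
    obtain ⟨hm, he⟩ := h u
    have hg := (adjoint (generator T)).mem_graph ⟨P u, hm⟩
    rw [adjoint_graph _ hd] at hg
    have hv : adjoint (generator T) ⟨P u, hm⟩ (v : X) = P u (generator T v) := hg v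
    rw [he, add_apply, hv]
  · intro h u
    have hu := (generator T).mem_graph u
    -- The equation forces the value of `A*` at `P u`; exhibiting it proves both membership in
    -- `D_{A*}` and the formula.
    have hg : (P u, Q u - P (generator T u)) ∈ (adjoint (generator T)).graph := by
      rw [adjoint_graph _ hd]
      intro v
      have hv := (generator T).mem_graph v
      rw [generator_graph] at hu hv
      change (Q u - P (generator T u)) v = P u (generator T v)
      rw [sub_apply, h _ _ _ _ hu hv, add_sub_cancel_right]
    have hm : P u ∈ (adjoint (generator T)).domain := LinearPMap.mem_domain_iff.2 ⟨_, hg⟩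
    refine ⟨hm, ?_⟩
    have he : adjoint (generator T) ⟨P u, hm⟩ = Q u - P (generator T u) := by
      rw [LinearPMap.mem_graph_iff] at hg
      obtain ⟨w, hw, hw'⟩ := hg
      exact (congrArg _ (Subtype.ext hw.symm)).trans hw'
    rw [he, sub_add_cancel]

theorem toOp_lyapunovSemigroup_apply (t : ℝ) (P : Ls X) (x y : X) :
    (lyapunovSemigroup T t P).toOp x y = P.toOp (T t x) (T t y) := rfl

/-- The integrated form of the equation `closure (A* P + P A) = Q`. -/
theorem integral_eq_of_isLyapunovExtension [CompleteSpace X] (hT : IsC0Semigroup T) {P Q : Ls X}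
    (h : IsLyapunovExtension (generator T) P.toOp Q.toOp) {t : ℝ} (ht : 0 ≤ t) (x y : X) :
    ∫ s in (0 : ℝ)..t, Q.toOp (T s x) (T s y) = P.toOp (T t x) (T t y) - P.toOp x y := by
  have hd := hT.dense_domain
  rw [isLyapunovExtension_iff hT] at h
  obtain ⟨M, hM⟩ := hT.exists_norm_le t
  -- With the integral realized as a bounded operator, both sides are continuous in `x` and `y`, and
  -- the identity need only be checked on `D_A`.
  obtain ⟨R, hR⟩ := exists_integral_conj (T := T) (μ := volume.restrict (Ioc 0 t))
    (b := fun _ => M ^ 2) (integrable_const _)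
    (fun x => ((hT.continuousOn x).mono
      fun s hs => le_of_lt hs.1).aestronglyMeasurable measurableSet_Ioc)
    (by
      filter_upwards [ae_restrict_mem measurableSet_Ioc] with s hs
      exact pow_le_pow_left₀ (norm_nonneg _) (hM s (Ioc_subset_Icc_self hs)) 2)
  have hRi : ∀ x y, ∫ s in (0 : ℝ)..t, Q.toOp (T s x) (T s y) = (R Q).toOp x y := fun x y => by
    rw [(hR Q x y).2, intervalIntegral.integral_of_le ht]
  have key : ∀ x ∈ (generator T).domain, ∀ y ∈ (generator T).domain,
      (R Q).toOp x y = (lyapunovSemigroup T t P - P).toOp x y := by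
    intro x hx y hy
    obtain ⟨x', hx⟩ := mem_generator_domain_iff.1 hx
    obtain ⟨y', hy⟩ := mem_generator_domain_iff.1 hy
    rw [← hRi, map_sub, sub_apply, sub_apply, toOp_lyapunovSemigroup_apply]
    have hi := intervalIntegral.integral_eq_sub_of_hasDeriv_right (a := 0) (b := t)
      (f := fun s => P.toOp (T s x) (T s y)) (f' := fun s => Q.toOp (T s x) (T s y))
      ((hT.continuousOn_form P.toOp x y).mono fun s hs => (le_inf le_rfl ht).trans hs.1)
      (fun s hs => by
        have hs' : 0 ≤ s := by
          rw [min_eq_left ht] at hs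
          exact le_of_lt hs.1
        have h₁ := (P.toOp.hasFDerivAt.comp_hasDerivWithinAt s
          (hT.hasDerivWithinAt hx hs')).clm_apply (hT.hasDerivWithinAt hy hs')
        -- Orbits stay in `D_A`, so the weak equation at `T(s)x, T(s)y` identifies the product-rule
        -- derivative with the integrand.
        rw [h _ _ _ _ (hT.apply_mem_generatorGraph hx hs') (hT.apply_mem_generatorGraph hy hs'),
          add_comm]
        exact h₁)
      (intervalIntegrable_of_continuousOn_Ici (hT.continuousOn_form Q.toOp x y) le_rfl ht)
    rw [hi]
    simp only [hT.zero_apply]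
  have h₁ : ∀ x ∈ (generator T).domain,
      (R Q).toOp x = (lyapunovSemigroup T t P - P).toOp x := fun x hx =>
    ContinuousLinearMap.coeFn_injective
      (Continuous.ext_on hd (map_continuous _) (map_continuous _) (key x hx))
  have h₂ : (R Q).toOp = (lyapunovSemigroup T t P - P).toOp :=
    ContinuousLinearMap.coeFn_injective
      (Continuous.ext_on hd (map_continuous _) (map_continuous _) h₁)
  rw [hRi, h₂, map_sub, sub_apply, sub_apply, toOp_lyapunovSemigroup_apply]

/-- The difference quotient at `t` is the average over `[0, t]` of `T*(s) Q T(s)`. For `t ≤ 1` its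
norm is at most `‖Q‖ M²`, so convergence has to be tested on elementary tensors only, where it is
continuity of the integrand at `0`. -/
theorem mem_lyapunovGeneratorGraph_of_integral_eq [CompleteSpace X] (hT : IsC0Semigroup T)
    {P Q : Ls X} (h : ∀ t : ℝ, 0 ≤ t → ∀ x y : X,
      ∫ s in (0 : ℝ)..t, Q.toOp (T s x) (T s y) = P.toOp (T t x) (T t y) - P.toOp x y) :
    (P, Q) ∈ lyapunovGeneratorGraph T := by
  obtain ⟨M, hM⟩ := hT.exists_norm_le 1
  have hap : ∀ (t : ℝ) (x y : X), (t⁻¹ • (lyapunovSemigroup T t P - P)).toOp x y =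
      t⁻¹ * (P.toOp (T t x) (T t y) - P.toOp x y) := by
    intro t x y
    rw [map_smul, map_sub, smul_apply, smul_apply, sub_apply, sub_apply,
      toOp_lyapunovSemigroup_apply, smul_eq_mul]
  have hbd : ∀ᶠ t : ℝ in 𝓝[>] 0,
      ‖t⁻¹ • (lyapunovSemigroup T t P - P)‖ ≤ ‖Q‖ * M ^ 2 := by
    filter_upwards [Ioc_mem_nhdsGT (zero_lt_one' ℝ)] with t ht
    rw [← Ls.norm_toOp]
    refine ContinuousLinearMap.opNorm_le_bound₂ _ (by positivity) fun x y => ?_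
    rw [hap, ← h t (le_of_lt ht.1), norm_mul, norm_inv, Real.norm_of_nonneg (le_of_lt ht.1),
      inv_mul_le_iff₀ ht.1]
    refine (intervalIntegral.norm_integral_le_of_norm_le_const
      (C := ‖Q‖ * M ^ 2 * ‖x‖ * ‖y‖) fun s hs => ?_).trans_eq ?_
    · rw [uIoc_of_le (le_of_lt ht.1)] at hs
      have hs' := hM s ⟨le_of_lt hs.1, hs.2.trans ht.2⟩
      calc ‖Q.toOp (T s x) (T s y)‖ ≤ ‖Q.toOp‖ * ‖T s x‖ * ‖T s y‖ := Q.toOp.le_opNorm₂ _ _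
        _ ≤ ‖Q‖ * (M * ‖x‖) * (M * ‖y‖) := by
          rw [Ls.norm_toOp]
          have hM0 : 0 ≤ M := (norm_nonneg _).trans hs'
          gcongr <;> exact (T s).le_of_opNorm_le hs' _
        _ = _ := by ring
    · rw [sub_zero, abs_of_pos ht.1]
      ring
  intro ρ hρ
  refine tendsto_of_mem_topologicalClosure_span hbd ?_ hρ
  rintro _ ⟨x, y, rfl⟩
  have h₁ := tendsto_average_of_continuousOn (hT.continuousOn_form Q.toOp x y) le_rfl
  simp only [hT.zero_apply] at h₁
  refine h₁.congr' ?_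
  filter_upwards [self_mem_nhdsWithin] with t ht
  rw [tensorFunctional_apply, hap, zero_add, intervalIntegral.integral_same, sub_zero,
    h t (le_of_lt ht), smul_eq_mul]

/-- Product rule at `0`: the increment of `⟨P T(t)x, T(t)y⟩` splits into `⟨P x, T(t)y - y⟩ + ⟨P
(T(t)x - x), T(t)y⟩`. Uniqueness of limits then gives the weak equation. -/
theorem isLyapunovExtension_of_mem_lyapunovGeneratorGraph [CompleteSpace X]
    (hT : IsC0Semigroup T) {P Q : Ls X} (h : (P, Q) ∈ lyapunovGeneratorGraph T) :
    IsLyapunovExtension (generator T) P.toOp Q.toOp := by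
  rw [isLyapunovExtension_iff hT]
  intro x x' y y' hx hy
  have h₁ := h (tensorFunctional x y)
    (Submodule.le_topologicalClosure _ (Submodule.subset_span ⟨x, y, rfl⟩))
  refine tendsto_nhds_unique h₁ ?_
  have hx' : Tendsto (fun t : ℝ => t⁻¹ • (T t x - x)) (𝓝[>] 0) (𝓝 x') := hx
  have hy' : Tendsto (fun t : ℝ => t⁻¹ • (T t y - y)) (𝓝[>] 0) (𝓝 y') := hy
  have h₂ := ((P.toOp x).continuous.tendsto y').comp hy'
  have hc : Continuous fun p : X × X => P.toOp p.1 p.2 := by fun_prop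
  have h₃ := (hc.tendsto (x', y)).comp (hx'.prodMk_nhds (hT.tendsto_zero y))
  refine (h₂.add h₃).congr fun t => ?_
  rw [tensorFunctional_apply, map_smul, map_sub, smul_apply, smul_apply, sub_apply, sub_apply,
    toOp_lyapunovSemigroup_apply]
  simp only [Function.comp_apply, map_smul, map_sub, smul_apply, sub_apply, smul_eq_mul]
  ring

theorem mem_lyapunovGeneratorGraph_iff [CompleteSpace X] (hT : IsC0Semigroup T) {P Q : Ls X} :
    (P, Q) ∈ lyapunovGeneratorGraph T ↔ IsLyapunovExtension (generator T) P.toOp Q.toOp :=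
  ⟨isLyapunovExtension_of_mem_lyapunovGeneratorGraph hT, fun h =>
    mem_lyapunovGeneratorGraph_of_integral_eq hT fun _ ht =>
      integral_eq_of_isLyapunovExtension hT h ht⟩

theorem lyapunovGenerator_eq_lyapunovOperator [CompleteSpace X] (hT : IsC0Semigroup T) :
    lyapunovGenerator T = lyapunovOperator (generator T) := by
  refine LinearPMap.eq_of_eq_graph ?_
  rw [lyapunovGenerator_graph, lyapunovOperator_graph _ hT.dense_domain]
  ext ⟨P, Q⟩
  exact mem_lyapunovGeneratorGraph_iff hT

/-! ### Datko's theorem -/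

/-- An operator all of whose orbits are square summable has a power of norm less than one. -/
theorem exists_norm_pow_lt_one_of_summable [CompleteSpace X] (S : X →L[ℝ] X)
    (hS : ∀ x, Summable fun n : ℕ => ‖(S ^ n) x‖ ^ 2) : ∃ n : ℕ, 0 < n ∧ ‖S ^ n‖ < 1 := by
  obtain ⟨L, hL⟩ := banach_steinhaus (g := fun n : ℕ => S ^ n) fun x => by
    refine ⟨√(∑' n : ℕ, ‖(S ^ n) x‖ ^ 2), fun n => Real.le_sqrt_of_sq_le ?_⟩
    exact (hS x).le_tsum n fun _ _ => sq_nonneg _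
  have hL0 : 0 ≤ L := (norm_nonneg _).trans (hL 0)
  -- Since `‖Sⁿx‖ ≤ L ‖Sᵏx‖` for each `k < n`, summing over `k` bounds `n ‖Sⁿx‖²` uniformly in `n`.
  -- A second use of uniform boundedness gives `√n ‖Sⁿ‖ ≤ K`, so any `n > K²` works.
  obtain ⟨K, hK⟩ := banach_steinhaus (g := fun n : ℕ => √(n : ℝ) • S ^ n) fun x => by
    refine ⟨√(L ^ 2 * ∑' n : ℕ, ‖(S ^ n) x‖ ^ 2), fun n => Real.le_sqrt_of_sq_le ?_⟩
    rw [smul_apply, norm_smul, mul_pow, Real.norm_of_nonneg (Real.sqrt_nonneg _),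
      Real.sq_sqrt (Nat.cast_nonneg n)]
    calc (n : ℝ) * ‖(S ^ n) x‖ ^ 2 = ∑ _k ∈ Finset.range n, ‖(S ^ n) x‖ ^ 2 := by simp
      _ ≤ ∑ k ∈ Finset.range n, L ^ 2 * ‖(S ^ k) x‖ ^ 2 := by
        refine Finset.sum_le_sum fun k hk => ?_
        rw [← mul_pow]
        refine pow_le_pow_left₀ (norm_nonneg _) ?_ 2
        have h : S ^ n = S ^ (n - k) * S ^ k := by
          rw [← pow_add, Nat.sub_add_cancel (Finset.mem_range.1 hk).le]
        rw [h]
        exact (S ^ (n - k)).le_of_opNorm_le (hL _) _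
      _ ≤ L ^ 2 * ∑' n : ℕ, ‖(S ^ n) x‖ ^ 2 := by
        rw [← Finset.mul_sum]
        exact mul_le_mul_of_nonneg_left ((hS x).sum_le_tsum _ fun _ _ => sq_nonneg _)
          (sq_nonneg L)
  obtain ⟨n, hn⟩ := exists_nat_gt (K ^ 2)
  have hn0 : (0 : ℝ) < n := (sq_nonneg K).trans_lt hn
  refine ⟨n, Nat.cast_pos.1 hn0, ?_⟩
  have h := hK n
  rw [norm_smul, Real.norm_of_nonneg (Real.sqrt_nonneg _)] at h
  have hs : K < √(n : ℝ) := Real.lt_sqrt_of_sq_lt hn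
  by_contra! h1
  have := mul_le_mul_of_nonneg_left h1 (Real.sqrt_nonneg (n : ℝ))
  linarith

theorem IsC0Semigroup.pow_eq (hT : IsC0Semigroup T) {τ : ℝ} (hτ : 0 ≤ τ) (n : ℕ) :
    T τ ^ n = T (n * τ) := by
  induction n with
  | zero =>
    rw [pow_zero, Nat.cast_zero, zero_mul, hT.map_zero]
    rfl
  | succ n ih =>
    rw [pow_succ, ih, Nat.cast_succ, add_mul, one_mul, hT.map_add _ _ (by positivity) hτ]
    rfl

/-- Write `t = kτ + r` with `0 ≤ r < τ`: the power `T(τ)ᵏ` decays geometrically and `T(r)` is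
bounded. -/
theorem IsC0Semigroup.isExpStable_of_norm_lt_one [CompleteSpace X] (hT : IsC0Semigroup T)
    {τ : ℝ} (hτ : 0 < τ) (h : ‖T τ‖ < 1) : IsExpStable T := by
  obtain ⟨M, hM⟩ := hT.exists_norm_le τ
  have hM0 : 0 ≤ M := (norm_nonneg _).trans (hM 0 ⟨le_rfl, hτ.le⟩)
  -- A strictly positive `q` keeps `log q` meaningful even when `T τ = 0`.
  obtain ⟨q, hq, hq1⟩ : ∃ q, max ‖T τ‖ 0 < q ∧ q < 1 :=
    exists_between (max_lt h one_pos)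
  have hq0 : 0 < q := (le_max_right _ _).trans_lt hq
  have hTq : ‖T τ‖ ≤ q := (le_max_left _ _).trans hq.le
  have hlog : Real.log q < 0 := Real.log_neg hq0 hq1
  -- The rate turns `q ^ (t / τ)` into an exponential; the factor `exp (-log q) = 1 / q` pays for
  -- rounding `t / τ` down to `k`.
  refine ⟨Real.exp (-Real.log q) * M, -Real.log q / τ, div_pos (neg_pos.2 hlog) hτ,
    fun t ht => ?_⟩
  set k := ⌊t / τ⌋₊ with hk
  have hk1 : (k : ℝ) * τ ≤ t := (le_div_iff₀ hτ).1 (Nat.floor_le (by positivity))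
  have hk2 : t / τ < k + 1 := Nat.lt_floor_add_one _
  have hk3 : t < (k + 1) * τ := (div_lt_iff₀ hτ).1 hk2
  have hpow : ‖T τ ^ k‖ ≤ q ^ k := by
    rcases Nat.eq_zero_or_pos k with h0 | h0
    · rw [h0, pow_zero, pow_zero]
      exact ContinuousLinearMap.norm_id_le
    · exact (norm_pow_le' _ h0).trans (pow_le_pow_left₀ (norm_nonneg _) hTq k)
  have hexp : q ^ k ≤ Real.exp (-Real.log q) * Real.exp (-(-Real.log q / τ) * t) := by
    rw [← Real.exp_add]
    nth_rewrite 1 [← Real.exp_log hq0]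
    rw [← Real.exp_nat_mul, Real.exp_le_exp]
    have : -(-Real.log q / τ) * t = t / τ * Real.log q := by ring
    rw [this]
    nlinarith
  have hsplit : T t = (T τ ^ k).comp (T (t - k * τ)) := by
    rw [hT.pow_eq hτ.le, ← hT.map_add _ _ (by positivity) (sub_nonneg.2 hk1), add_sub_cancel]
  calc ‖T t‖ ≤ ‖T τ ^ k‖ * ‖T (t - k * τ)‖ := by
        rw [hsplit]
        exact ContinuousLinearMap.opNorm_comp_le _ _
    _ ≤ (Real.exp (-Real.log q) * Real.exp (-(-Real.log q / τ) * t)) * M := by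
        gcongr
        · exact hpow.trans hexp
        · exact hM _ ⟨sub_nonneg.2 hk1, by linarith⟩
    _ = _ := by ring

/-- **Datko's theorem**: a `C₀` semigroup with square integrable orbits is exponentially stable. -/
theorem IsC0Semigroup.isExpStable_of_integrableOn [CompleteSpace X] (hT : IsC0Semigroup T)
    (h : ∀ x, IntegrableOn (fun t : ℝ => ‖T t x‖ ^ 2) (Ioi 0)) : IsExpStable T := by
  obtain ⟨M, hM⟩ := hT.exists_norm_le 1
  have hsum : ∀ x, Summable fun n : ℕ => ‖(T 1 ^ n) x‖ ^ 2 := by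
    intro x
    have hcont : ContinuousOn (fun t => ‖T t x‖ ^ 2) (Ici 0) := (hT.continuousOn x).norm.pow 2
    have hint : ∀ a b : ℝ, 0 ≤ a → 0 ≤ b →
        IntervalIntegrable (fun t => ‖T t x‖ ^ 2) volume a b := fun a b ha hb =>
      intervalIntegrable_of_continuousOn_Ici hcont ha hb
    -- The term at `k + 1` is compared with the integral over `[k, k + 1]`, because `T(k + 1)x = T(k
    -- + 1 - s) T(s)x` for `s` in that interval; the term at `0` has no interval before it.
    rw [← summable_nat_add_iff 1]
    refine summable_of_sum_range_le (c := M ^ 2 * ∫ t in Ioi (0 : ℝ), ‖T t x‖ ^ 2)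
      (fun _ => sq_nonneg _) fun n => ?_
    have hstep : ∀ k : ℕ, ‖(T 1 ^ (k + 1)) x‖ ^ 2 ≤
        M ^ 2 * ∫ t in (k : ℝ)..(k + 1 : ℕ), ‖T t x‖ ^ 2 := by
      intro k
      have hk : (k : ℝ) ≤ (k + 1 : ℕ) := by push_cast; linarith
      have hk0 : (0 : ℝ) ≤ k := k.cast_nonneg
      rw [← intervalIntegral.integral_const_mul]
      have hc := intervalIntegral.integral_mono_on hk
        (intervalIntegrable_const (μ := volume) (c := ‖(T 1 ^ (k + 1)) x‖ ^ 2))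
        ((hint k (k + 1 : ℕ) hk0 (hk0.trans hk)).const_mul (M ^ 2)) fun s hs => by
          have hs1 : 0 ≤ (k + 1 : ℕ) - s := sub_nonneg.2 hs.2
          have hs2 : (k + 1 : ℕ) - s ≤ 1 := by
            push_cast
            linarith [hs.1]
          rw [← mul_pow]
          refine pow_le_pow_left₀ (norm_nonneg _) ?_ 2
          have he : (T 1 ^ (k + 1)) x = T ((k + 1 : ℕ) - s) (T s x) := by
            rw [hT.pow_eq zero_le_one, mul_one, ← hT.add_apply hs1 (hk0.trans hs.1),
              sub_add_cancel]
          rw [he]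
          exact (T _).le_of_opNorm_le (hM _ ⟨hs1, hs2⟩) _
      rw [intervalIntegral.integral_const, Nat.cast_succ, add_sub_cancel_left, one_smul] at hc
      rwa [Nat.cast_succ]
    calc ∑ k ∈ Finset.range n, ‖(T 1 ^ (k + 1)) x‖ ^ 2
        ≤ ∑ k ∈ Finset.range n, M ^ 2 * ∫ t in (k : ℝ)..(k + 1 : ℕ), ‖T t x‖ ^ 2 :=
          Finset.sum_le_sum fun k _ => hstep k
      _ = M ^ 2 * ∫ t in ((0 : ℕ) : ℝ)..n, ‖T t x‖ ^ 2 := by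
          rw [← Finset.mul_sum, intervalIntegral.sum_integral_adjacent_intervals
            (a := fun k : ℕ => (k : ℝ)) fun k _ => hint _ _ k.cast_nonneg (k + 1).cast_nonneg]
      _ ≤ _ := by
          refine mul_le_mul_of_nonneg_left ?_ (sq_nonneg M)
          rw [Nat.cast_zero, intervalIntegral.integral_of_le n.cast_nonneg]
          exact setIntegral_mono_set (h x) (Eventually.of_forall fun _ => sq_nonneg _)
            (Eventually.of_forall fun _ hs => hs.1)
  obtain ⟨n, hn, hlt⟩ := exists_norm_pow_lt_one_of_summable (T 1) hsum
  rw [hT.pow_eq zero_le_one, mul_one] at hlt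
  exact hT.isExpStable_of_norm_lt_one (Nat.cast_pos.2 hn) hlt

theorem IsExpStable.tendsto_zero (h : IsExpStable T) (x : X) :
    Tendsto (fun t => T t x) atTop (𝓝 0) := by
  obtain ⟨M, ε, hε, hM⟩ := h
  have h₁ : Tendsto (fun t : ℝ => M * Real.exp (-ε * t) * ‖x‖) atTop (𝓝 (M * 0 * ‖x‖)) := by
    refine (Tendsto.const_mul M (Real.tendsto_exp_atBot.comp ?_)).mul_const _
    exact tendsto_id.const_mul_atTop_of_neg (neg_neg_of_pos hε)
  rw [mul_zero, zero_mul] at h₁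
  refine squeeze_zero_norm' ?_ h₁
  filter_upwards [eventually_ge_atTop 0] with t ht using (T t).le_of_opNorm_le (hM t ht) x

/-! ### The inverse of the Lyapunov generator -/

/-- For an exponentially stable semigroup, `-∫₀^∞ T*(s) Q T(s) ds` inverts the Lyapunov
generator. -/
theorem exists_isBoundedInverse_of_isExpStable [CompleteSpace X] (hT : IsC0Semigroup T)
    (h : IsExpStable T) :
    ∃ R : Ls X →L[ℝ] Ls X, IsBoundedInverse (lyapunovGenerator T) R ∧
      ∀ Q : Ls X, IsPosDef Q → IsPosDef (-R Q) := by
  obtain ⟨M, ε, hε, hM⟩ := id h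
  obtain ⟨R, hR⟩ := exists_integral_conj (T := T) (μ := volume.restrict (Ioi 0))
    ((exp_neg_integrableOn_Ioi 0 (b := 2 * ε) (by positivity)).const_mul (M ^ 2))
    (fun x => ((hT.continuousOn x).mono Ioi_subset_Ici_self).aestronglyMeasurable
      measurableSet_Ioi)
    (by
      filter_upwards [ae_restrict_mem measurableSet_Ioi] with s hs
      refine (pow_le_pow_left₀ (norm_nonneg _) (hM s (le_of_lt hs)) 2).trans_eq ?_
      rw [mul_pow, ← Real.exp_nat_mul]
      congr 2
      push_cast
      ring)
  have hgraph : ∀ Q : Ls X, (-R Q, Q) ∈ (lyapunovGenerator T).graph := by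
    intro Q
    rw [lyapunovGenerator_graph]
    refine mem_lyapunovGeneratorGraph_of_integral_eq hT fun t ht x y => ?_
    have hneg : ∀ x y, (-R Q).toOp x y = -(R Q).toOp x y := fun x y => by
      rw [map_neg, neg_apply, neg_apply]
    -- Conjugating by `T(t)` leaves only the tail integral over `(t, ∞)`, so the increment of `-R Q`
    -- is the integral over `(0, t]`.
    have hshift : (R Q).toOp (T t x) (T t y) =
        ∫ s in Ioi t, Q.toOp (T s x) (T s y) := by
      have h₁ := (measurePreserving_add_right volume t).setIntegral_preimage_emb
        (measurableEmbedding_addRight t) (fun s => Q.toOp (T s x) (T s y)) (Ioi t)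
      rw [preimage_add_const_Ioi, sub_self] at h₁
      rw [(hR Q _ _).2, ← h₁]
      refine setIntegral_congr_fun measurableSet_Ioi fun s hs => ?_
      simp only [hT.add_apply (le_of_lt (mem_Ioi.1 hs)) ht]
    have hi := (hR Q x y).1
    rw [hneg, hneg, hshift, (hR Q x y).2, intervalIntegral.integral_of_le ht,
      ← Ioc_union_Ioi_eq_Ioi ht, setIntegral_union (Ioc_disjoint_Ioi le_rfl) measurableSet_Ioi
        (IntegrableOn.mono_set hi Ioc_subset_Ioi_self)
        (IntegrableOn.mono_set hi (Ioi_subset_Ioi ht))]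
    ring
  refine ⟨-R, ⟨fun P => ?_, fun Q => ?_⟩, fun Q hQ x => ?_⟩
  · have hP := (lyapunovGenerator T).mem_graph P
    set Q := lyapunovGenerator T P with hQ
    rw [lyapunovGenerator_graph, mem_lyapunovGeneratorGraph_iff hT] at hP
    refine Ls.ext (ContinuousLinearMap.ext fun x => ContinuousLinearMap.ext fun y => ?_)
    -- Letting `t → ∞` in the integrated identity, the term `⟨P T(t)x, T(t)y⟩` vanishes, which
    -- leaves `R Q = -P`.
    have h₁ := intervalIntegral_tendsto_integral_Ioi 0 (hR Q x y).1 tendsto_id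
    have hc : Continuous fun p : X × X => (P : Ls X).toOp p.1 p.2 := by fun_prop
    have h₂ := ((hc.tendsto (0, 0)).comp
      ((h.tendsto_zero x).prodMk_nhds (h.tendsto_zero y))).sub_const ((P : Ls X).toOp x y)
    have h₃ := tendsto_nhds_unique h₁ (h₂.congr' (by
      filter_upwards [eventually_ge_atTop 0] with t ht
      exact (integral_eq_of_isLyapunovExtension hT hP ht x y).symm))
    rw [neg_apply, map_neg, neg_apply, neg_apply, (hR Q x y).2, h₃]
    simp
  · have hQ := hgraph Q
    rw [LinearPMap.mem_graph_iff] at hQ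
    obtain ⟨P, hP, hPQ⟩ := hQ
    have hP' : (-R) Q = P := hP.symm
    rw [hP']
    exact ⟨P.2, hPQ⟩
  · rw [neg_apply, neg_neg, (hR Q x x).2]
    exact integral_nonneg fun s => hQ _

/-! ### The observation operator and the equivalence -/

variable {N : Type*} [NormedAddCommGroup N] [InnerProductSpace ℝ N]

/-- `C* C` as an element of `L_s(X, X*)`. -/
noncomputable def symmStarMul (C : X →L[ℝ] N) : Ls X :=
  Ls.mk (starMul C) fun x y => by rw [starMul_apply, starMul_apply, real_inner_comm]

theorem toOp_symmStarMul (C : X →L[ℝ] N) : (symmStarMul C).toOp = starMul C := rfl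

theorem isPosDef_symmStarMul (C : X →L[ℝ] N) : IsPosDef (symmStarMul C) := fun x => by
  rw [toOp_symmStarMul, starMul_apply]
  exact real_inner_self_nonneg

/-- By the integrated identity, `∫₀ᵗ ‖C T(s)x‖² ds = ⟨P x, x⟩ - ⟨P T(t)x, T(t)x⟩`, and positivity of
`P` bounds this by `⟨P x, x⟩` for every `t ≥ 0`. -/
theorem integrableOn_norm_sq_of_isLyapunovExtension [CompleteSpace X] (hT : IsC0Semigroup T)
    (C : X →L[ℝ] N) {P : Ls X} (hP : IsPosDef P)
    (h : IsLyapunovExtension (generator T) P.toOp (-starMul C)) (x : X) :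
    IntegrableOn (fun t : ℝ => ‖C (T t x)‖ ^ 2) (Ioi 0) := by
  have hcont : ContinuousOn (fun t => ‖C (T t x)‖ ^ 2) (Ici 0) :=
    (C.continuous.comp_continuousOn (hT.continuousOn x)).norm.pow 2
  have h' : IsLyapunovExtension (generator T) P.toOp (-symmStarMul C).toOp := by
    rwa [map_neg, toOp_symmStarMul]
  refine integrableOn_Ioi_of_intervalIntegral_norm_bounded (P.toOp x x) 0 (b := id) (l := atTop)
    (fun t => ((hcont.mono fun s hs => hs.1).integrableOn_Icc).mono_set Ioc_subset_Icc_self)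
    tendsto_id ?_
  filter_upwards [eventually_ge_atTop 0] with t ht
  have h₁ := integral_eq_of_isLyapunovExtension hT h' ht x x
  have h₂ : ∀ s, (-symmStarMul C).toOp (T s x) (T s x) = -‖C (T s x)‖ ^ 2 := fun s => by
    rw [map_neg, neg_apply, neg_apply, toOp_symmStarMul, starMul_apply,
      real_inner_self_eq_norm_sq]
  simp only [h₂, intervalIntegral.integral_neg] at h₁
  simp only [norm_pow, norm_norm, id]
  linarith [hP (T t x)]

end Lyapunov

theorem mainTheorem1 {X : Type*} [NormedAddCommGroup X] [NormedSpace ℝ X] [CompleteSpace X]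
    (hX : Lyapunov.IsReflexive X)
    {N : Type*} [NormedAddCommGroup N] [InnerProductSpace ℝ N] [CompleteSpace N]
    (T : ℝ → X →L[ℝ] X) (hT : Lyapunov.IsC0Semigroup T)
    (C : X →L[ℝ] N) (hC : Lyapunov.IsDetectable C T) :
    Lyapunov.lyapunovGenerator T = Lyapunov.lyapunovOperator (Lyapunov.generator T) ∧
    List.TFAE [
      ∃ P : Lyapunov.Ls X, Lyapunov.IsPosDef P ∧
        Lyapunov.IsLyapunovExtension (Lyapunov.generator T) P.toOp (-Lyapunov.starMul C),
      Lyapunov.IsExpStable T,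
      ∃ R : Lyapunov.Ls X →L[ℝ] Lyapunov.Ls X,
        Lyapunov.IsBoundedInverse (Lyapunov.lyapunovGenerator T) R ∧
          ∀ Q : Lyapunov.Ls X, Lyapunov.IsPosDef Q → Lyapunov.IsPosDef (-R Q)] := by
  refine ⟨Lyapunov.lyapunovGenerator_eq_lyapunovOperator hT, ?_⟩
  tfae_have 1 → 2 := fun ⟨P, hP, h⟩ => hT.isExpStable_of_integrableOn fun x =>
    hC x (Lyapunov.integrableOn_norm_sq_of_isLyapunovExtension hT C hP h x)
  tfae_have 2 → 3 := Lyapunov.exists_isBoundedInverse_of_isExpStable hT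
  tfae_have 3 → 1 := by
    rintro ⟨R, ⟨-, hR⟩, hpos⟩
    refine ⟨-R (Lyapunov.symmStarMul C), hpos _ (Lyapunov.isPosDef_symmStarMul C), ?_⟩
    obtain ⟨hm, he⟩ := hR (Lyapunov.symmStarMul C)
    have hg := (Lyapunov.lyapunovGenerator T).mem_graph ⟨_, hm⟩
    rw [he] at hg
    -- The graph is a subspace, so negation turns `𝒜 (R (C*C)) = C*C` into the equation with
    -- right-hand side `-C*C`.
    have hg' := neg_mem hg
    rw [Lyapunov.lyapunovGenerator_graph] at hg'
    have h := Lyapunov.isLyapunovExtension_of_mem_lyapunovGeneratorGraph hT hg'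
    rwa [map_neg Lyapunov.Ls.toOp (Lyapunov.symmStarMul C), Lyapunov.toOp_symmStarMul] at h
  tfae_finish
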